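/- All topological groups are Hausdorff, and a unitary representation of a topological group $G$ is a homomorphism from $G$ to the unitary group of a complex Hilbert space that is continuous for the strong operator topology. For such a representation $\rho$ let $P_\rho$ be the set of finite sums of functions $g\mapsto(\rho(g)x,x)$ with $x$ in the space of $\rho$. The Fell topology on a set $\mathcal S$ of unitary equivalence classes of unitary representations of $G$ has as a base of neighbourhoods of $[\rho]\in\mathcal S$ the sets $\{[\sigma]\in\mathcal S:\ \exists g_1,\dots,g_n\in P_\sigma\ \forall i\ \forall x\in C\ |f_i(x)-g_i(x)|<\varepsilon\}$, where $f_1,\dots,f_n\in P_\rho$, $C\subseteq G$ is compact and $\varepsilon>0$. Let $1_G$ be the class of the trivial one-dimensional representation. For a set $\mathcal R$ of classes of unitary representations of $G$, the group $G$ has property (T) with respect to $\mathcal R$ if $1_G$ is isolated in $\mathcal R\cup\{1_G\}$ in the Fell topology; $G$ has property (T) if this holds for every set $\mathcal R$ of classes of unitary representations of $G$ without non-zero invariant vectors. A topological group is precompact if it is isomorphic, as a topological group, to a subgroup of a compact group. Theorem. Let $G$ be a precompact group such that every compact subset of $G$ is countable (finite or countably infinite), and let $G_d$ be the same group equipped with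 the discrete topology. Let $\mathcal R$ be the set of equivalence classes of finite-dimensional unitary representations of $G$ (continuous for the original topology of $G$) without non-zero invariant vectors, regarded as a set of classes of unitary representations of $G_d$. Then $G$ has property (T) if and only if $G_d$ has property (T) with respect to $\mathcal R$. -/

import Mathlib

open Topology

universe u v

/-- A topological group is precompact if it is isomorphic, as a topological group, to a subgroup
of a compact Hausdorff group. (The completion of `G` lives in the universe of `G`.) -/
def IsPrecompactGroup (G : Type u) [Group G] [TopologicalSpace G] : Prop :=
  ∃ (K : Type u) (_ : Group K) (_ : TopologicalSpace K) (_ : IsTopologicalGroup K)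
    (_ : CompactSpace K) (_ : T2Space K) (φ : G →* K), IsEmbedding φ

/-- A unitary representation of `G`: a homomorphism to the unitary group of a complex Hilbert
space, continuous for the strong operator topology (pointwise convergence). -/
structure UnitaryRep (G : Type u) [Group G] [TopologicalSpace G] where
  V : Type v
  [normed : NormedAddCommGroup V]
  [innerProd : InnerProductSpace ℂ V]
  [complete : CompleteSpace V]
  hom : G →* (V ≃ₗᵢ[ℂ] V)
  continuous_apply : ∀ x : V, Continuous fun g : G => hom g x

attribute [instance] UnitaryRep.normed UnitaryRep.innerProd UnitaryRep.complete

namespace UnitaryRep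

section

variable {G : Type u} [Group G] [TopologicalSpace G]

/-- Unitary equivalence of representations. -/
def Equivalent (ρ σ : UnitaryRep.{u, v} G) : Prop :=
  ∃ M : ρ.V ≃ₗᵢ[ℂ] σ.V, ∀ (g : G) (x : ρ.V), M (ρ.hom g x) = σ.hom g (M x)

instance setoid (G : Type u) [Group G] [TopologicalSpace G] :
    Setoid (UnitaryRep.{u, v} G) where
  r := Equivalent
  iseqv :=
    { refl := fun ρ => ⟨LinearIsometryEquiv.refl ℂ ρ.V, fun _ _ => rfl⟩
      symm := fun {ρ σ} ⟨M, hM⟩ =>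
        ⟨M.symm, fun g x => by
          apply M.injective
          rw [hM, M.apply_symm_apply, M.apply_symm_apply]⟩
      trans := fun {ρ σ τ} ⟨M, hM⟩ ⟨N, hN⟩ =>
        ⟨M.trans N, fun g x => by simp [hM, hN]⟩ }

/-- The trivial representation, on a one-dimensional Hilbert space. -/
noncomputable def trivial (G : Type u) [Group G] [TopologicalSpace G] : UnitaryRep.{u, v} G where
  V := EuclideanSpace ℂ PUnit.{v + 1}
  hom := 1
  continuous_apply := fun _ => continuous_const

def HasNoInvariantVectors (ρ : UnitaryRep.{u, v} G) : Prop :=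
  ∀ x : ρ.V, (∀ g : G, ρ.hom g x = x) → x = 0

/-- The functions `g ↦ (ρ(g) x, x)` of positive type associated with `ρ`. (Mathlib's inner product
is linear in the second variable.) -/
def posTypeFunctions (ρ : UnitaryRep.{u, v} G) : Set (G → ℂ) :=
  {f | ∃ x : ρ.V, f = fun g => inner ℂ x (ρ.hom g x)}

/-- The convex cone generated by the functions of positive type associated with `ρ`:
the set of their finite sums. -/
def posTypeCone (ρ : UnitaryRep.{u, v} G) : Set (G → ℂ) :=
  {f | ∃ (n : ℕ) (h : Fin n → G → ℂ), (∀ i, h i ∈ ρ.posTypeFunctions) ∧ f = ∑ i, h i}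

theorem posTypeFunctions_subset_of_equivalent {ρ σ : UnitaryRep.{u, v} G} (e : Equivalent ρ σ) :
    ρ.posTypeFunctions ⊆ σ.posTypeFunctions := by
  obtain ⟨M, hM⟩ := e
  rintro f ⟨x, rfl⟩
  refine ⟨M x, ?_⟩
  funext g
  rw [← hM, M.inner_map_map]

theorem posTypeCone_eq_of_equivalent {ρ σ : UnitaryRep.{u, v} G} (e : ρ ≈ σ) :
    ρ.posTypeCone = σ.posTypeCone := by
  have e' : σ ≈ ρ := Setoid.symm e
  apply Set.Subset.antisymm
  · rintro f ⟨n, h, hh, rfl⟩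
    exact ⟨n, h, fun i => posTypeFunctions_subset_of_equivalent e (hh i), rfl⟩
  · rintro f ⟨n, h, hh, rfl⟩
    exact ⟨n, h, fun i => posTypeFunctions_subset_of_equivalent e' (hh i), rfl⟩

end

end UnitaryRep

/-- Equivalence classes of unitary representations of `G`. -/
def UnitaryClass (G : Type u) [Group G] [TopologicalSpace G] : Type (max u (v + 1)) :=
  Quotient (UnitaryRep.setoid.{u, v} G)

namespace UnitaryClass

section

variable {G : Type u} [Group G] [TopologicalSpace G]

/-- The class of a representation. -/
def mk (ρ : UnitaryRep.{u, v} G) : UnitaryClass.{u, v} G := Quotient.mk _ ρ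

/-- The class `1_G` of the trivial representation. -/
noncomputable def one (G : Type u) [Group G] [TopologicalSpace G] : UnitaryClass.{u, v} G :=
  mk (UnitaryRep.trivial.{u, v} G)

/-- The cone of functions of positive type attached to a class. -/
def posTypeCone (c : UnitaryClass.{u, v} G) : Set (G → ℂ) :=
  Quotient.lift UnitaryRep.posTypeCone
    (fun _ _ e => UnitaryRep.posTypeCone_eq_of_equivalent e) c

/-- The set `W(f₁, …, fₙ, C, ε)` with `F = {f₁, …, fₙ}`. -/
def fellNhd (F : Set (G → ℂ)) (C : Set G) (ε : ℝ) : Set (UnitaryClass.{u, v} G) :=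
  {c | ∀ f ∈ F, ∃ g ∈ c.posTypeCone, ∀ x ∈ C, ‖f x - g x‖ < ε}

/-- The Fell topology: a set is open if with each class `c` it contains some
`W(f₁, …, fₙ, C, ε)` with the `fᵢ` in the cone of `c`, `C` compact and `ε > 0`.
The Fell topology on a set of classes is the subspace topology. -/
instance fellTopology (G : Type u) [Group G] [TopologicalSpace G] :
    TopologicalSpace (UnitaryClass.{u, v} G) where
  IsOpen U := ∀ c ∈ U, ∃ (F : Set (G → ℂ)) (C : Set G) (ε : ℝ),
    F.Finite ∧ F ⊆ c.posTypeCone ∧ IsCompact C ∧ 0 < ε ∧ fellNhd F C ε ⊆ U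
  isOpen_univ := fun _ _ =>
    ⟨∅, ∅, 1, Set.finite_empty, Set.empty_subset _, isCompact_empty, one_pos, Set.subset_univ _⟩
  isOpen_inter := by
    rintro U U' hU hU' c ⟨hc, hc'⟩
    obtain ⟨F, C, ε, hF, hFc, hC, hε, hW⟩ := hU c hc
    obtain ⟨F', C', ε', hF', hFc', hC', hε', hW'⟩ := hU' c hc'
    refine ⟨F ∪ F', C ∪ C', min ε ε', hF.union hF', Set.union_subset hFc hFc', hC.union hC',
      lt_min hε hε', fun d hd => ⟨hW fun f hf => ?_, hW' fun f hf => ?_⟩⟩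
    · obtain ⟨g, hg, h⟩ := hd f (Or.inl hf)
      exact ⟨g, hg, fun x hx => (h x (Or.inl hx)).trans_le (min_le_left _ _)⟩
    · obtain ⟨g, hg, h⟩ := hd f (Or.inr hf)
      exact ⟨g, hg, fun x hx => (h x (Or.inr hx)).trans_le (min_le_right _ _)⟩
  isOpen_sUnion := by
    rintro S hS c ⟨U, hU, hc⟩
    obtain ⟨F, C, ε, hF, hFc, hC, hε, hW⟩ := hS U hU c hc
    exact ⟨F, C, ε, hF, hFc, hC, hε, hW.trans (Set.subset_sUnion_of_mem hU)⟩

theorem continuous_of_mem_posTypeCone {c : UnitaryClass.{u, v} G} {f : G → ℂ}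
    (hf : f ∈ c.posTypeCone) : Continuous f := by
  induction c using Quotient.inductionOn with
  | h ρ =>
    obtain ⟨n, h, hh, rfl⟩ := hf
    have hcont : ∀ i, Continuous (h i) := fun i => by
      obtain ⟨x, hx⟩ := hh i
      rw [hx]
      exact Continuous.inner (𝕜 := ℂ) continuous_const (ρ.continuous_apply x)
    have : (∑ i, h i) = fun x => ∑ i, h i x := by
      funext x
      simp
    rw [this]
    exact continuous_finsetSum _ fun i _ => hcont i

/-- The sets `W(f₁, …, fₙ, C, ε)` are open, hence they are a base of neighbourhoods of every class
whose cone contains the `fᵢ`. -/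
theorem isOpen_fellNhd {c : UnitaryClass.{u, v} G} {F : Set (G → ℂ)} {C : Set G} {ε : ℝ}
    (hF : F.Finite) (hFc : F ⊆ c.posTypeCone) (hC : IsCompact C) :
    IsOpen (fellNhd.{u, v} F C ε) := by
  intro d hd
  choose! g hg h using hd
  have key : ∀ f ∈ F, ∃ δ > 0, ∀ x ∈ C, ‖f x - g f x‖ + δ ≤ ε := by
    intro f hf
    rcases C.eq_empty_or_nonempty with rfl | hne
    · exact ⟨1, one_pos, by simp⟩
    · have hc : ContinuousOn (fun x => ‖f x - g f x‖) C :=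
        (((continuous_of_mem_posTypeCone (hFc hf)).sub
          (continuous_of_mem_posTypeCone (hg f hf))).norm).continuousOn
      obtain ⟨y, hy, hmax⟩ := hC.exists_isMaxOn hne hc
      refine ⟨ε - ‖f y - g f y‖, sub_pos.2 (h f hf y hy), fun x hx => ?_⟩
      have := hmax hx
      simp only [Set.mem_ofPred_eq] at this
      linarith
  choose! δ hδ hle using key
  obtain ⟨η, hη, hηle⟩ : ∃ η > 0, ∀ f ∈ F, η ≤ δ f := by
    rcases F.eq_empty_or_nonempty with rfl | hne
    · exact ⟨1, one_pos, by simp⟩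
    · obtain ⟨f₀, hf₀, hmin⟩ := Set.exists_min_image F δ hF hne
      exact ⟨δ f₀, hδ f₀ hf₀, hmin⟩
  refine ⟨g '' F, C, η, hF.image g, ?_, hC, hη, ?_⟩
  · rintro _ ⟨f, hf, rfl⟩
    exact hg f hf
  · intro e he f hf
    obtain ⟨k, hk, hke⟩ := he (g f) ⟨f, hf, rfl⟩
    refine ⟨k, hk, fun x hx => ?_⟩
    have h1 := hke x hx
    have h2 := hle f hf x hx
    have h3 := hηle f hf
    have h4 := norm_sub_le_norm_sub_add_norm_sub (f x) (g f x) (k x)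
    linarith

end

end UnitaryClass

/-- Property (T) of `G` with respect to a set `R` of classes of unitary representations:
`1_G` is isolated in `R ∪ {1_G}` for the Fell topology. -/
def HasPropertyTWithRespectTo {G : Type u} [Group G] [TopologicalSpace G]
    (R : Set (UnitaryClass.{u, v} G)) : Prop :=
  IsOpen ({⟨UnitaryClass.one.{u, v} G, Or.inr rfl⟩} :
    Set ↥(R ∪ {UnitaryClass.one.{u, v} G}))

/-- Property (T): `1_G` is isolated in `R ∪ {1_G}` for every set `R` of classes of unitary
representations of `G` without non-zero invariant vectors. -/
def HasPropertyT (G : Type u) [Group G] [TopologicalSpace G] : Prop :=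
  ∀ R : Set (UnitaryClass.{u, v} G),
    (∀ ρ : UnitaryRep.{u, v} G, UnitaryClass.mk ρ ∈ R → ρ.HasNoInvariantVectors) →
      HasPropertyTWithRespectTo R

/-- The group `G_d`: the group `G` with the discrete topology. -/
def Discretization (G : Type u) : Type u := G

instance (G : Type u) [Group G] : Group (Discretization G) := inferInstanceAs (Group G)

instance (G : Type u) : TopologicalSpace (Discretization G) := ⊥

instance (G : Type u) : DiscreteTopology (Discretization G) := ⟨rfl⟩

/-- The identity homomorphism `G_d → G`. -/
def Discretization.toGroup (G : Type u) [Group G] : Discretization G →* G := MonoidHom.id G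

/-- A unitary representation of `G`, viewed as a representation of `G_d`. -/
def UnitaryRep.discretize {G : Type u} [Group G] [TopologicalSpace G]
    (ρ : UnitaryRep.{u, v} G) : UnitaryRep.{u, v} (Discretization G) where
  V := ρ.V
  hom := ρ.hom.comp (Discretization.toGroup G)
  continuous_apply := fun _ => continuous_of_discreteTopology

/-- The class of a representation of `G`, viewed as the class of a representation of `G_d`. -/
def UnitaryClass.discretize {G : Type u} [Group G] [TopologicalSpace G] :
    UnitaryClass.{u, v} G → UnitaryClass.{u, v} (Discretization G) :=
  Quotient.map UnitaryRep.discretize fun _ _ ⟨M, hM⟩ => ⟨M, fun g x => hM g x⟩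

/-- The classes of finite-dimensional (continuous) unitary representations of `G` without non-zero
invariant vectors. -/
def finDimClassesWithoutInvariants (G : Type u) [Group G] [TopologicalSpace G] :
    Set (UnitaryClass.{u, v} G) :=
  {c | ∃ ρ : UnitaryRep.{u, v} G, UnitaryClass.mk ρ = c ∧
    FiniteDimensional ℂ ρ.V ∧ ρ.HasNoInvariantVectors}

/-! Every function in the cone of `1_G` is a non-negative constant, so property (T) with respect to
`R` says that for some compact `C` and `ε > 0` no function in the cone of a class in `R` is
`ε`-close to `1` on all of `C` (`hasPropertyTWithRespectTo_iff`).

From `G_d` to `G`: by a Peter–Weyl argument (`dense_finiteVectors`) the functions of positive type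
of any representation of a precompact group are approximated uniformly on the whole group by those
of finite-dimensional representations, and invariant vectors are not created. A pair `(C, ε)` for
`G_d` thus yields `(C, ε/2)` for `G`; here `C` is finite, hence compact in `G`.

From `G` to `G_d`: if every finite set fails for `G_d`, then enumerating a countable compact `C`
gives functions of positive type that converge to `1` pointwise on `C` and are uniformly bounded.
Dominated convergence and Hahn–Banach (Mazur's argument) give convex combinations converging
uniformly on `C`. These lie in cones of finite direct sums, which are again finite-dimensional
without invariant vectors, so `C` fails for `G` (`exists_norm_one_sub_lt_of_countable`). -/

namespace UnitaryRep

/-! ### Operations on representations and their cones of positive type functions -/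

variable {G : Type u} [Group G] [TopologicalSpace G]

/-- The direct sum of a finite family of unitary representations. -/
noncomputable def directSum {ι : Type} [Fintype ι] (ρ : ι → UnitaryRep.{u, v} G) :
    UnitaryRep.{u, v} G where
  V := PiLp 2 fun i => (ρ i).V
  hom :=
    { toFun := fun g => LinearIsometryEquiv.piLpCongrRight 2 fun i => (ρ i).hom g
      map_one' := by ext; simp
      map_mul' := fun g h => by ext; simp }
  continuous_apply := fun x =>
    (PiLp.continuous_toLp 2 _).comp (continuous_pi fun i => (ρ i).continuous_apply (x i))

theorem directSum_hom_apply {ι : Type} [Fintype ι] (ρ : ι → UnitaryRep.{u, v} G) (g : G)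
    (x : PiLp 2 fun i => (ρ i).V) (i : ι) :
    (show PiLp 2 fun i => (ρ i).V from (directSum ρ).hom g x) i = (ρ i).hom g (x i) := rfl

theorem HasNoInvariantVectors.directSum {ι : Type} [Fintype ι] {ρ : ι → UnitaryRep.{u, v} G}
    (h : ∀ i, (ρ i).HasNoInvariantVectors) : (directSum ρ).HasNoInvariantVectors := by
  intro x hx
  exact PiLp.ext fun i => h i _ fun g => congrArg (fun y : PiLp 2 fun i => (ρ i).V => y i) (hx g)

theorem finiteDimensional_directSum {ι : Type} [Fintype ι] {ρ : ι → UnitaryRep.{u, v} G}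
    (h : ∀ i, FiniteDimensional ℂ (ρ i).V) : FiniteDimensional ℂ (directSum ρ).V :=
  inferInstanceAs (FiniteDimensional ℂ (PiLp 2 fun i => (ρ i).V))

/-- The restriction of a unitary representation to an invariant closed subspace. -/
noncomputable def restrict (ρ : UnitaryRep.{u, v} G) (W : Submodule ℂ ρ.V) [CompleteSpace W]
    (hW : ∀ g, ∀ x ∈ W, ρ.hom g x ∈ W) : UnitaryRep.{u, v} G where
  V := W
  hom :=
    { toFun := fun g =>
        { toFun := fun x => ⟨ρ.hom g x, hW g x x.2⟩
          invFun := fun x => ⟨ρ.hom g⁻¹ x, hW g⁻¹ x x.2⟩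
          map_add' := fun x y => Subtype.ext (by simp)
          map_smul' := fun c x => Subtype.ext (by simp)
          left_inv := fun x => Subtype.ext (by simp)
          right_inv := fun x => Subtype.ext (by simp)
          norm_map' := fun x => (ρ.hom g).norm_map x }
      map_one' := by ext; simp
      map_mul' := fun g h => by ext; simp }
  continuous_apply := fun x => (ρ.continuous_apply x).subtype_mk _

theorem HasNoInvariantVectors.restrict {ρ : UnitaryRep.{u, v} G} (h : ρ.HasNoInvariantVectors)
    (W : Submodule ℂ ρ.V) [CompleteSpace W] (hW : ∀ g, ∀ x ∈ W, ρ.hom g x ∈ W) :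
    (ρ.restrict W hW).HasNoInvariantVectors :=
  fun _ hx => Subtype.ext (h _ fun g => congrArg Subtype.val (hx g))

theorem HasNoInvariantVectors.of_equivalent {ρ σ : UnitaryRep.{u, v} G}
    (h : ρ.HasNoInvariantVectors) (e : Equivalent ρ σ) : σ.HasNoInvariantVectors := by
  obtain ⟨M, hM⟩ := e
  intro x hx
  have := h (M.symm x) fun g => M.injective (by rw [hM, M.apply_symm_apply, hx])
  simpa using this

theorem posTypeCone_eq_closure (ρ : UnitaryRep.{u, v} G) :
    ρ.posTypeCone = AddSubmonoid.closure ρ.posTypeFunctions := by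
  ext f
  constructor
  · rintro ⟨n, h, hh, rfl⟩
    exact sum_mem fun i _ => AddSubmonoid.subset_closure (hh i)
  · intro hf
    obtain ⟨l, hl, rfl⟩ := AddSubmonoid.exists_list_of_mem_closure hf
    refine ⟨l.length, fun i => l[i], fun i => hl _ (l.getElem_mem _), ?_⟩
    rw [← List.sum_ofFn]
    simp

theorem sum_mem_posTypeCone {ρ : UnitaryRep.{u, v} G} {ι : Type*} (s : Finset ι) {f : ι → G → ℂ}
    (hf : ∀ i ∈ s, f i ∈ ρ.posTypeCone) : ∑ i ∈ s, f i ∈ ρ.posTypeCone := by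
  rw [posTypeCone_eq_closure] at *
  exact sum_mem hf

/-- Multiplying each vector by `√a` multiplies its function by `a`. With direct sums, this makes
convex combinations available. -/
theorem smul_mem_posTypeCone {ρ : UnitaryRep.{u, v} G} {f : G → ℂ} (hf : f ∈ ρ.posTypeCone)
    {a : ℝ} (ha : 0 ≤ a) : (fun g => (a : ℂ) * f g) ∈ ρ.posTypeCone := by
  obtain ⟨n, h, hh, rfl⟩ := hf
  refine ⟨n, fun i g => a * h i g, fun i => ?_, ?_⟩
  · obtain ⟨x, hx⟩ := hh i
    refine ⟨((√a : ℝ) : ℂ) • x, funext fun g => ?_⟩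
    simp only [hx]
    rw [map_smul, inner_smul_left, inner_smul_right, Complex.conj_ofReal, ← mul_assoc,
      ← Complex.ofReal_mul, Real.mul_self_sqrt ha]
  · funext g
    simp [Finset.mul_sum]

theorem posTypeCone_subset_directSum {ι : Type} [Fintype ι] (ρ : ι → UnitaryRep.{u, v} G)
    (i : ι) : (ρ i).posTypeCone ⊆ (directSum ρ).posTypeCone := by
  classical
  rintro f ⟨n, h, hh, rfl⟩
  refine ⟨n, h, fun k => ?_, rfl⟩
  obtain ⟨x, hx⟩ := hh k
  refine ⟨PiLp.single 2 i x, ?_⟩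
  rw [hx]
  funext g
  refine Eq.symm
    ((PiLp.inner_apply (𝕜 := ℂ) (f := fun i => (ρ i).V) (PiLp.single 2 i x) _).trans ?_)
  rw [Finset.sum_eq_single i]
  · rw [directSum_hom_apply]; simp
  · intro j _ hj
    simp [hj]
  · simp

theorem norm_apply_le_of_mem_posTypeCone {ρ : UnitaryRep.{u, v} G} {f : G → ℂ}
    (hf : f ∈ ρ.posTypeCone) (g : G) : ‖f g‖ ≤ ‖f 1‖ := by
  -- The real part is additive over the summands, so Cauchy–Schwarz can be applied term by term.
  suffices ‖f g‖ ≤ (f 1).re from this.trans (Complex.re_le_norm _)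
  obtain ⟨n, h, hh, rfl⟩ := hf
  simp only [Finset.sum_apply, Complex.re_sum]
  refine (norm_sum_le _ _).trans (Finset.sum_le_sum fun i _ => ?_)
  obtain ⟨x, hx⟩ := hh i
  rw [hx]
  refine (norm_inner_le_norm _ _).trans ?_
  rw [LinearIsometryEquiv.norm_map]
  simp only [map_one]
  simp [inner_self_eq_norm_sq_to_K, pow_two]

theorem eq_const_of_mem_posTypeCone_trivial {f : G → ℂ}
    (hf : f ∈ (trivial.{u, v} G).posTypeCone) : ∃ a : ℝ, 0 ≤ a ∧ f = fun _ => (a : ℂ) := by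
  obtain ⟨n, h, hh, rfl⟩ := hf
  choose x hx using hh
  refine ⟨∑ i, ‖x i‖ ^ 2, by positivity, funext fun g => ?_⟩
  simp only [Finset.sum_apply, Complex.ofReal_sum]
  refine Finset.sum_congr rfl fun i _ => ?_
  rw [hx]
  exact (inner_self_eq_norm_sq_to_K (𝕜 := ℂ) (x i)).trans (by simp)

theorem one_mem_posTypeCone_trivial : (fun _ => 1) ∈ (trivial.{u, v} G).posTypeCone := by
  refine ⟨1, fun _ _ => 1, fun _ => ⟨EuclideanSpace.single PUnit.unit 1, funext fun g => ?_⟩, ?_⟩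
  · refine Eq.symm ((inner_self_eq_norm_sq_to_K (𝕜 := ℂ)
      (EuclideanSpace.single PUnit.unit (1 : ℂ))).trans (by simp))
  · simp

theorem not_hasNoInvariantVectors_trivial : ¬ (trivial.{u, v} G).HasNoInvariantVectors := by
  intro h
  have h1 := h (EuclideanSpace.single PUnit.unit 1) fun _ => rfl
  have h2 := congrArg (fun y : EuclideanSpace ℂ PUnit.{v + 1} => y PUnit.unit) h1
  exact one_ne_zero ((by simp : (1 : ℂ) = _).trans h2)

end UnitaryRep

/-! ### Property (T) as a uniform gap from the constant function 1 -/

namespace UnitaryClass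

variable {G : Type u} [Group G] [TopologicalSpace G]

theorem mk_eq_iff {ρ σ : UnitaryRep.{u, v} G} : mk ρ = mk σ ↔ UnitaryRep.Equivalent ρ σ :=
  Quotient.eq

theorem exists_mk_eq (c : UnitaryClass.{u, v} G) : ∃ ρ, mk ρ = c := Quotient.exists_rep c

end UnitaryClass

/-- Property (T) with respect to `R` means that no function of positive type associated with a
class in `R` is uniformly close to `1` on a suitable compact set. -/
theorem hasPropertyTWithRespectTo_iff {G : Type u} [Group G] [TopologicalSpace G]
    {R : Set (UnitaryClass.{u, v} G)} (h1 : UnitaryClass.one G ∉ R) :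
    HasPropertyTWithRespectTo R ↔ ∃ C : Set G, IsCompact C ∧ ∃ ε > 0,
      ∀ c ∈ R, ∀ f ∈ c.posTypeCone, ∃ x ∈ C, ε ≤ ‖1 - f x‖ := by
  constructor
  · rintro ⟨U, hU, hUR⟩
    have h1U : UnitaryClass.one G ∈ U := by
      have : (⟨UnitaryClass.one G, Or.inr rfl⟩ : ↥(R ∪ {UnitaryClass.one G})) ∈
        Subtype.val ⁻¹' U := by rw [hUR]; rfl
      exact this
    obtain ⟨F, C, ε, hF, hFc, hC, hε, hW⟩ := hU _ h1U
    have hconst : ∀ f ∈ F, ∃ a : ℝ, 0 ≤ a ∧ f = fun _ => (a : ℂ) :=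
      fun f hf => UnitaryRep.eq_const_of_mem_posTypeCone_trivial (hFc hf)
    choose! a ha hfa using hconst
    obtain ⟨M, hM⟩ := (hF.image a).bddAbove
    -- Each `f ∈ F` is a constant `a f ≤ |M|`, and `a f * g` approximates it with error `a f * ‖1 -
    -- g x‖`; the `+ 1` keeps the denominator positive.
    refine ⟨C, hC, ε / (|M| + 1), by positivity, fun c hc g hg => ?_⟩
    by_contra! hlt
    have hcU : c ∈ U := by
      refine hW fun f hf => ⟨fun x => (a f : ℂ) * g x, ?_, fun x hx => ?_⟩
      · obtain ⟨ρ, rfl⟩ := c.exists_mk_eq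
        exact UnitaryRep.smul_mem_posTypeCone (ρ := ρ) hg (ha f hf)
      · have e : f x - a f * g x = a f * (1 - g x) := by
          rw [congrFun (hfa f hf) x]; ring
        rw [e, norm_mul, Complex.norm_real, Real.norm_of_nonneg (ha f hf)]
        have haM : a f ≤ |M| := (hM ⟨f, hf, rfl⟩).trans (le_abs_self M)
        have h2 := hlt x hx
        rw [lt_div_iff₀ (by positivity)] at h2
        nlinarith [norm_nonneg (1 - g x)]
    have : (⟨c, Or.inl hc⟩ : ↥(R ∪ {UnitaryClass.one G})) ∈ Subtype.val ⁻¹' U := hcU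
    rw [hUR] at this
    have h2 : c = UnitaryClass.one G := congrArg Subtype.val this
    exact h1 (h2 ▸ hc)
  · rintro ⟨C, hC, ε, hε, h⟩
    have hone : (fun _ => 1) ∈ (UnitaryClass.one.{u, v} G).posTypeCone :=
      UnitaryRep.one_mem_posTypeCone_trivial
    refine ⟨UnitaryClass.fellNhd {fun _ => 1} C ε, UnitaryClass.isOpen_fellNhd
      (c := UnitaryClass.one G) (Set.finite_singleton _) (Set.singleton_subset_iff.2 hone) hC, ?_⟩
    ext ⟨c, hc⟩
    constructor
    · intro hcW
      rcases hc with hc | hc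
      · obtain ⟨f, hf, hlt⟩ := hcW _ rfl
        obtain ⟨x, hx, hle⟩ := h c hc f hf
        exact absurd (hlt x hx) (not_lt.2 hle)
      · exact Subtype.ext hc
    · intro hc1
      have : c = UnitaryClass.one G := congrArg Subtype.val hc1
      subst this
      rintro f rfl
      exact ⟨_, hone, fun x _ => by simpa using hε⟩

/-! ### Peter–Weyl density via the compact completion -/

/-- A precompact group is a dense subgroup of a compact Hausdorff group. -/
theorem IsPrecompactGroup.exists_isDenseInducing {G : Type u} [Group G] [TopologicalSpace G]
    (hG : IsPrecompactGroup G) :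
    ∃ (K : Type u) (_ : Group K) (_ : TopologicalSpace K) (_ : IsTopologicalGroup K)
      (_ : CompactSpace K) (_ : T2Space K) (φ : G →* K), IsDenseInducing φ := by
  obtain ⟨K, _, _, _, _, _, φ, hφ⟩ := hG
  let H : Subgroup K := φ.range.topologicalClosure
  have hmem : ∀ g, φ g ∈ H := fun g => subset_closure ⟨g, rfl⟩
  refine ⟨H, inferInstance, inferInstance, inferInstance,
    isCompact_iff_compactSpace.1 φ.range.isClosed_topologicalClosure.isCompact, inferInstance,
    φ.codRestrict H hmem, ⟨?_⟩, ?_⟩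
  · exact (hφ.isInducing.codRestrict hmem).eq_induced
  · rintro ⟨k, hk⟩
    rw [closure_subtype, ← Set.range_comp]
    exact hk

namespace UnitaryRep

variable {G : Type u} [Group G] [TopologicalSpace G]

theorem norm_hom_sub_hom (ρ : UnitaryRep.{u, v} G) (g h : G) (x : ρ.V) :
    ‖ρ.hom g x - ρ.hom h x‖ = ‖ρ.hom (h⁻¹ * g) x - x‖ := by
  rw [← (ρ.hom h).norm_map (ρ.hom (h⁻¹ * g) x - x), map_sub, map_mul, map_inv]
  simp

theorem inner_hom_left (ρ : UnitaryRep.{u, v} G) (g : G) (x y : ρ.V) :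
    inner ℂ (ρ.hom g x) y = inner ℂ x (ρ.hom g⁻¹ y) := by
  rw [← (ρ.hom g⁻¹).inner_map_map, map_inv]
  simp

open Filter in
/-- The orbit maps of a unitary representation extend to the compact completion of the group. -/
theorem exists_continuous_orbit_extension (ρ : UnitaryRep.{u, v} G) {K : Type*} [Group K]
    [TopologicalSpace K] [IsTopologicalGroup K] [T2Space K] {φ : G →* K} (hφ : IsDenseInducing φ)
    (x : ρ.V) :
    ∃ u : K → ρ.V, Continuous u ∧ u 1 = x ∧ (∀ g, u (φ g) = ρ.hom g x) ∧
      ∀ g k, u (φ g * k) = ρ.hom g (u k) := by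
  -- The orbit map is uniformly continuous: `‖ρ(g)x - ρ(h)x‖` depends only on `h⁻¹ * g`. It
  -- therefore sends the trace on `G` of each neighbourhood filter in `K` to a Cauchy filter.
  have hlim : ∀ b : K, ∃ c, Tendsto (fun g => ρ.hom g x) (comap φ (𝓝 b)) (𝓝 c) := by
    intro b
    have := hφ.comap_nhds_neBot b
    refine cauchy_map_iff_exists_tendsto.1 (Metric.cauchy_iff.2 ⟨inferInstance, fun ε hε => ?_⟩)
    have h1 : {g : G | ‖ρ.hom g x - x‖ < ε} ∈ 𝓝 (1 : G) := by
      have hc : Continuous fun g => ‖ρ.hom g x - x‖ :=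
        ((ρ.continuous_apply x).sub continuous_const).norm
      exact hc.continuousAt.eventually_lt continuousAt_const (by simpa using hε)
    rw [hφ.isInducing.nhds_eq_comap, map_one] at h1
    obtain ⟨U, hU, hUsub⟩ := h1
    have h2 : Tendsto (fun p : K × K => p.2⁻¹ * p.1) (𝓝 b ×ˢ 𝓝 b) (𝓝 1) := by
      rw [← nhds_prod_eq]
      have : Continuous fun p : K × K => p.2⁻¹ * p.1 := by fun_prop
      simpa using this.tendsto (b, b)
    obtain ⟨N, hN, hNU⟩ :=
      (eventually_prod_self_iff (r := fun x y => y⁻¹ * x ∈ U)).1 (h2.eventually_mem hU)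
    refine ⟨_, image_mem_map (preimage_mem_comap hN), ?_⟩
    rintro _ ⟨g, hg, rfl⟩ _ ⟨h, hh, rfl⟩
    rw [dist_eq_norm, norm_hom_sub_hom]
    refine hUsub ?_
    rw [Set.mem_preimage, map_mul, map_inv]
    exact hNU _ hg _ hh
  have hc : Continuous (hφ.extend fun g => ρ.hom g x) := hφ.continuous_extend hlim
  have he : ∀ g, hφ.extend (fun g => ρ.hom g x) (φ g) = ρ.hom g x :=
    fun g => hφ.extend_eq (ρ.continuous_apply x) g
  refine ⟨_, hc, ?_, he, fun g k => ?_⟩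
  · simpa using he 1
  · refine hφ.dense.induction_on (p := fun k => hφ.extend (fun g => ρ.hom g x) (φ g * k) =
      ρ.hom g (hφ.extend (fun g => ρ.hom g x) k)) k
      (isClosed_eq (hc.comp (continuous_const.mul continuous_id))
        ((ρ.hom g).continuous.comp hc)) fun h => ?_
    rw [← map_mul, he, he, map_mul]
    rfl

/-- The vectors contained in a finite-dimensional invariant subspace. -/
def finiteVectors (ρ : UnitaryRep.{u, v} G) : Submodule ℂ ρ.V where
  carrier := {x | ∃ W : Submodule ℂ ρ.V, FiniteDimensional ℂ W ∧
    (∀ g, ∀ y ∈ W, ρ.hom g y ∈ W) ∧ x ∈ W}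
  zero_mem' := ⟨⊥, inferInstance, by simp, by simp⟩
  add_mem' := by
    rintro x y ⟨W, hW, hWi, hx⟩ ⟨W', hW', hWi', hy⟩
    refine ⟨W ⊔ W', inferInstance, fun g z hz => ?_, Submodule.add_mem_sup hx hy⟩
    obtain ⟨a, ha, b, hb, rfl⟩ := Submodule.mem_sup.1 hz
    rw [map_add]
    exact Submodule.add_mem_sup (hWi g a ha) (hWi' g b hb)
  smul_mem' := by
    rintro c x ⟨W, hW, hWi, hx⟩
    exact ⟨W, hW, hWi, W.smul_mem c hx⟩

theorem hom_mem_finiteVectors (ρ : UnitaryRep.{u, v} G) (g : G) {x : ρ.V}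
    (hx : x ∈ ρ.finiteVectors) : ρ.hom g x ∈ ρ.finiteVectors := by
  obtain ⟨W, hW, hWi, hx⟩ := hx
  exact ⟨W, hW, hWi, hWi g x hx⟩

/-- Eigenvectors of an intertwining compact self-adjoint operator for a non-zero eigenvalue lie in
a finite-dimensional invariant subspace. -/
theorem mem_finiteVectors_of_eigenvector (ρ : UnitaryRep.{u, v} G) {A : ρ.V →L[ℂ] ρ.V}
    (hA : IsCompactOperator A) (hcomm : ∀ g x, A (ρ.hom g x) = ρ.hom g (A x)) {μ : ℂ} (hμ : μ ≠ 0)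
    {x : ρ.V} (hx : A x = μ • x) : x ∈ ρ.finiteVectors := by
  refine ⟨Module.End.eigenspace A.toLinearMap μ,
    ContinuousLinearMap.finite_dimensional_eigenspace hA μ hμ, fun g y hy => ?_,
    Module.End.mem_eigenspace_iff.2 hx⟩
  rw [Module.End.mem_eigenspace_iff] at hy ⊢
  have hy' : A y = μ • y := hy
  exact (hcomm g y).trans (by rw [hy', map_smul])

open MeasureTheory InnerProductSpace in
/-- The vectors of a representation of a precompact group which are contained in a
finite-dimensional invariant subspace form a dense subspace. -/
theorem dense_finiteVectors (hG : IsPrecompactGroup G) (ρ : UnitaryRep.{u, v} G) :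
    Dense (ρ.finiteVectors : Set ρ.V) := by
  rw [Submodule.dense_iff_topologicalClosure_eq_top, Submodule.topologicalClosure_eq_top_iff,
    Submodule.eq_bot_iff]
  intro x hx
  obtain ⟨K, _, _, _, _, _, φ, hφ⟩ := hG.exists_isDenseInducing
  obtain ⟨u, hu, hu1, huφ, huK⟩ := ρ.exists_continuous_orbit_extension hφ x
  borelize K
  let m : Measure K := Measure.haarMeasure ⊤
  have hm : IsProbabilityMeasure m := ⟨by
    simpa using Measure.haarMeasure_self (K₀ := (⊤ : TopologicalSpace.PositiveCompacts K))⟩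
  let Q : K → ρ.V →L[ℂ] ρ.V := fun k => rankOne ℂ (u k) (u k)
  have hQ : Continuous Q :=
    (ContinuousLinearMap.smulRightL ℂ ρ.V ρ.V).continuous₂.comp
      (((innerSL ℂ).continuous.comp hu).prodMk hu)
  have hint : ∀ {E : Type v} [NormedAddCommGroup E] {f : K → E}, Continuous f → Integrable f m :=
    fun hf => hf.integrable_of_hasCompactSupport (HasCompactSupport.of_compactSpace _)
  -- Averaging the rank-one operators along the orbit of `x` gives a compact self-adjoint
  -- intertwiner. Only the extended orbit map is needed, not an action of `K` on the space.
  let A : ρ.V →L[ℂ] ρ.V := ∫ k, Q k ∂m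
  have hA : ∀ y, A y = ∫ k, inner ℂ (u k) y • u k ∂m := fun y =>
    ContinuousLinearMap.integral_apply (hint hQ) y
  have hAinner : ∀ y z, inner ℂ z (A y) = ∫ k, inner ℂ (u k) y * inner ℂ z (u k) ∂m := by
    intro y z
    rw [hA, ← integral_inner (hint (by fun_prop))]
    simp_rw [inner_smul_right]
  have hAcomm : ∀ g y, A (ρ.hom g y) = ρ.hom g (A y) := by
    intro g y
    rw [hA, hA, ← integral_mul_left_eq_self _ (φ g)]
    simp_rw [huK, LinearIsometryEquiv.inner_map_map, ← map_smul]
    exact (ρ.hom g).toContinuousLinearEquiv.integral_comp_comm _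
  have hAsymm : A.IsSymmetric := by
    intro y z
    change inner ℂ (A y) z = inner ℂ y (A z)
    rw [← inner_conj_symm, hAinner, hAinner, ← integral_conj]
    refine integral_congr_ae (Filter.Eventually.of_forall fun k => ?_)
    simp [mul_comm]
  have hAcomp : IsCompactOperator A := by
    -- The compact operators form a closed convex set, which contains the average of its members
    -- over a probability measure.
    refine Convex.integral_mem (μ := m) (s := {f : ρ.V →L[ℂ] ρ.V | IsCompactOperator f}) (f := Q)
      ((compactOperator (RingHom.id ℂ) ρ.V ρ.V).restrictScalars ℝ).convex
      isClosed_setOfPred_isCompactOperator (Filter.Eventually.of_forall fun k => ?_) (hint hQ)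
    have := (isCompactOperator_of_locallyCompactSpace_rng
      (ContinuousLinearMap.toSpanSingleton ℂ (u k))).comp_clm (innerSL ℂ (u k))
    exact this
  have horth : ∀ k, ∀ y ∈ ρ.finiteVectors, inner ℂ (u k) y = 0 := by
    intro k y hy
    refine hφ.dense.induction_on (p := fun k => inner ℂ (u k) y = 0) k
      (isClosed_eq (hu.inner continuous_const) continuous_const) fun g => ?_
    rw [huφ, inner_hom_left]
    exact Submodule.inner_left_of_mem_orthogonal (ρ.hom_mem_finiteVectors g⁻¹ hy) hx
  -- An eigenvector for a non-zero eigenvalue would be a finite vector, hence orthogonal to every `u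
  -- k`, hence killed by `A`. A compact self-adjoint operator without non-zero eigenvalues vanishes.
  have hA0 : A = 0 := by
    refine (ContinuousLinearMap.eq_zero_of_forall_hasEigenvalue_eq_zero hAcomp hAsymm).1
      fun μ hμ => ?_
    by_contra hne
    obtain ⟨y, hy⟩ := hμ.exists_hasEigenvector
    have hyA : A y = μ • y := hy.apply_eq_smul
    have h0 : A y = 0 := by
      rw [hA]
      simp [horth _ y (ρ.mem_finiteVectors_of_eigenvector hAcomp hAcomm hne hyA)]
    rw [hyA] at h0
    exact (smul_ne_zero hne hy.2) h0
  have hzero : ∫ k, ‖inner ℂ (u k) x‖ ^ 2 ∂m = 0 := by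
    have h1 := hAinner x x
    rw [hA0] at h1
    have h2 : ∀ k, inner ℂ (u k) x * inner ℂ x (u k) = ((‖inner ℂ (u k) x‖ ^ 2 : ℝ) : ℂ) := by
      intro k
      rw [← inner_conj_symm x, Complex.mul_conj, Complex.normSq_eq_norm_sq]
    simp_rw [h2] at h1
    rw [integral_complex_ofReal] at h1
    simpa using h1.symm
  -- Haar measure charges non-empty open sets, so the integrand vanishes everywhere; at `k = 1` it
  -- is `‖x‖ ^ 4`.
  have hcont : Continuous fun k => ‖inner ℂ (u k) x‖ ^ 2 :=
    ((hu.inner continuous_const).norm).pow 2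
  have hae := (hcont.integral_pos_of_hasCompactSupport_nonneg_nonzero (μ := m)
    (HasCompactSupport.of_compactSpace _) (fun k => sq_nonneg _) (x := 1))
  by_contra hne
  refine (hae ?_).ne' hzero
  rw [hu1]
  simpa using hne

end UnitaryRep

/-! ### From pointwise to uniform convergence by convex combinations -/

open MeasureTheory Filter in
/-- Over a compact space, convex combinations of a bounded pointwise null sequence of real functions
are eventually below any positive constant. -/
theorem ContinuousMap.exists_mem_convexHull_lt {X : Type*} [TopologicalSpace X] [CompactSpace X]
    [T2Space X] {f : ℕ → C(X, ℝ)} {M : ℝ} (hM : ∀ n x, ‖f n x‖ ≤ M)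
    (hf : ∀ x, Tendsto (fun n => f n x) atTop (𝓝 0)) {ε : ℝ} (hε : 0 < ε) :
    ∃ g ∈ convexHull ℝ (Set.range f), ∀ x, g x < ε := by
  by_contra! hcon
  have hopen : IsOpen {g : C(X, ℝ) | ∀ x, g x < ε} := by
    simpa [Set.MapsTo] using
      ContinuousMap.isOpen_setOfPred_mapsTo (X := X) (Y := ℝ) isCompact_univ (isOpen_Iio (a := ε))
  have hconv : Convex ℝ {g : C(X, ℝ) | ∀ x, g x < ε} := by
    intro g hg h hh a b ha hb hab x
    exact (convex_Iio ε) (hg x) (hh x) ha hb hab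
  have hdisj : Disjoint {g : C(X, ℝ) | ∀ x, g x < ε} (convexHull ℝ (Set.range f)) := by
    refine Set.disjoint_left.2 fun g hg hg' => ?_
    obtain ⟨x, hx⟩ := hcon g hg'
    exact absurd (hg x) (not_lt.2 hx)
  obtain ⟨φ, s, hφs, hφt⟩ :=
    geometric_hahn_banach_open hconv hopen (convex_convexHull ℝ (Set.range f)) hdisj
  have hs : 0 < s := by simpa using hφs 0 fun x => by simpa using hε
  -- The separated open set contains all non-positive functions, which forces `φ` to be positive and
  -- so, by Riesz, integration against a finite measure.
  have hpos : ∀ g : C(X, ℝ), (∀ x, 0 ≤ g x) → 0 ≤ φ g := by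
    intro g hg
    by_contra! hlt
    have h1 := hφs ((s / φ g) • g) fun x => by
      have : (s / φ g) * g x ≤ 0 :=
        mul_nonpos_of_nonpos_of_nonneg (div_neg_of_pos_of_neg hs hlt).le (hg x)
      simpa using this.trans_lt hε
    rw [map_smul, smul_eq_mul, div_mul_cancel₀ _ hlt.ne] at h1
    exact lt_irrefl _ h1
  borelize X
  let Λ : CompactlySupportedContinuousMap X ℝ →ₚ[ℝ] ℝ := PositiveLinearMap.mk₀
    { toFun := fun g => φ g.toContinuousMap
      map_add' := fun g h => map_add φ g.toContinuousMap h.toContinuousMap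
      map_smul' := fun a g => map_smul φ a g.toContinuousMap }
    (fun g hg => hpos _ fun x => hg x)
  have hΛ : ∀ g : C(X, ℝ), φ g = ∫ x, g x ∂(RealRMK.rieszMeasure Λ) := fun g =>
    (RealRMK.integral_rieszMeasure Λ
      (CompactlySupportedContinuousMap.continuousMapEquiv g)).symm
  have hlim : Tendsto (fun n => φ (f n)) atTop (𝓝 0) := by
    simp_rw [hΛ]
    have : IsFiniteMeasure (RealRMK.rieszMeasure Λ) :=
      isFiniteMeasure_iff_isFiniteMeasureOnCompacts_of_compactSpace.2 inferInstance
    have := tendsto_integral_of_dominated_convergence (μ := RealRMK.rieszMeasure Λ)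
      (F := fun n x => f n x) (f := fun _ => (0 : ℝ)) (fun _ => M)
      (fun n => (f n).continuous.aestronglyMeasurable) (integrable_const M)
      (fun n => Eventually.of_forall (hM n)) (Eventually.of_forall hf)
    simpa using this
  exact absurd (ge_of_tendsto' hlim fun n => hφt _ (subset_convexHull ℝ _ ⟨n, rfl⟩))
    (not_le.2 hs)

open Filter in
/-- Over a compact space, a bounded pointwise null sequence of continuous functions has convex
combinations which are uniformly small. -/
theorem ContinuousMap.exists_convex_combination_norm_lt {X : Type*} [TopologicalSpace X]
    [CompactSpace X] [T2Space X] {f : ℕ → C(X, ℂ)} {M : ℝ} (hM : ∀ n x, ‖f n x‖ ≤ M)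
    (hf : ∀ x, Tendsto (fun n => f n x) atTop (𝓝 0)) {ε : ℝ} (hε : 0 < ε) :
    ∃ (ι : Type) (_ : Fintype ι) (w : ι → ℝ) (n : ι → ℕ), (∀ i, 0 ≤ w i) ∧ ∑ i, w i = 1 ∧
      ∀ x, ‖∑ i, (w i : ℂ) * f (n i) x‖ < ε := by
  -- The four copies of `X` carry `Re f`, `-Im f`, `-Re f` and `Im f`, so one set of weights bounds
  -- both parts from both sides.
  let h : ℕ → C(X × Fin 4, ℝ) := fun n =>
    ⟨fun p => (Complex.I ^ (p.2 : ℕ) * f n p.1).re, by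
      have : Continuous fun j : Fin 4 => Complex.I ^ (j : ℕ) := continuous_of_discreteTopology
      fun_prop⟩
  have hh : ∀ n p, h n p = (Complex.I ^ (p.2 : ℕ) * f n p.1).re := fun _ _ => rfl
  obtain ⟨g, hg, hlt⟩ := ContinuousMap.exists_mem_convexHull_lt (f := h) (M := M)
    (fun n p => by
      rw [hh, Real.norm_eq_abs]
      refine (Complex.abs_re_le_norm _).trans ?_
      simpa using hM n p.1)
    (fun p => by
      simp_rw [hh]
      have := (Complex.continuous_re.tendsto _).comp
        ((hf p.1).const_mul (Complex.I ^ (p.2 : ℕ)))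
      simpa [Function.comp_def] using this) (half_pos hε)
  obtain ⟨ι, hι, w, z, hw, hw1, hz, rfl⟩ := mem_convexHull_iff_exists_fintype.1 hg
  choose n hn using hz
  refine ⟨ι, hι, w, n, hw, hw1, fun x => ?_⟩
  set S := ∑ i, (w i : ℂ) * f (n i) x with hS
  have key : ∀ j : Fin 4, (Complex.I ^ (j : ℕ) * S).re < ε / 2 := by
    intro j
    convert hlt (x, j) using 1
    simp only [hS, Finset.mul_sum, Complex.re_sum, ContinuousMap.sum_apply, ContinuousMap.smul_apply,
      ← hn, hh, smul_eq_mul]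
    refine Finset.sum_congr rfl fun i _ => ?_
    rw [mul_left_comm, Complex.re_ofReal_mul]
  have h0 := key 0
  have h1 := key 1
  have h2 := key 2
  have h3 := key 3
  simp [pow_succ] at h0 h1 h2 h3
  refine (Complex.norm_le_abs_re_add_abs_im S).trans_lt ?_
  have := abs_lt.2 ⟨by linarith, h0⟩
  have := abs_lt.2 ⟨by linarith, h3⟩
  linarith

/-! ### Uniform approximation by finite-dimensional representations -/

namespace UnitaryRep

variable {G : Type u} [Group G] [TopologicalSpace G]

/-- The functions of positive type of a representation of a precompact group are uniformly
approximated by those of its finite-dimensional subrepresentations. -/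
theorem exists_finiteDimensional_norm_sub_lt (hG : IsPrecompactGroup G) {ρ : UnitaryRep.{u, v} G}
    (hρ : ρ.HasNoInvariantVectors) {f : G → ℂ} (hf : f ∈ ρ.posTypeCone) {ε : ℝ} (hε : 0 < ε) :
    ∃ σ : UnitaryRep.{u, v} G, FiniteDimensional ℂ σ.V ∧ σ.HasNoInvariantVectors ∧
      ∃ f' ∈ σ.posTypeCone, ∀ g, ‖f g - f' g‖ < ε := by
  obtain ⟨n, h, hh, rfl⟩ := hf
  choose x hx using hh
  have happrox : ∀ i, ∃ y ∈ ρ.finiteVectors,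
      ∀ g, ‖inner ℂ (x i) (ρ.hom g (x i)) - inner ℂ y (ρ.hom g y)‖ < ε / (n + 1) := by
    intro i
    -- This majorant of the difference of the two functions does not depend on `g` and vanishes at
    -- `y = x i`.
    have hcont : Continuous fun y : ρ.V => ‖x i - y‖ * ‖x i‖ + ‖y‖ * ‖x i - y‖ := by fun_prop
    have hopen : IsOpen {y : ρ.V | ‖x i - y‖ * ‖x i‖ + ‖y‖ * ‖x i - y‖ < ε / (n + 1)} :=
      isOpen_lt hcont continuous_const
    obtain ⟨y, hy, hyf⟩ := (dense_finiteVectors hG ρ).inter_open_nonempty _ hopen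
      ⟨x i, by simp; positivity⟩
    refine ⟨y, hyf, fun g => lt_of_le_of_lt ?_ hy⟩
    have e : inner ℂ (x i) (ρ.hom g (x i)) - inner ℂ y (ρ.hom g y) =
        inner ℂ (x i - y) (ρ.hom g (x i)) + inner ℂ y (ρ.hom g (x i - y)) := by
      rw [inner_sub_left, map_sub, inner_sub_right]
      ring
    rw [e]
    refine (norm_add_le _ _).trans (add_le_add ?_ ?_)
    · simpa only [LinearIsometryEquiv.norm_map] using
        norm_inner_le_norm (𝕜 := ℂ) (x i - y) (ρ.hom g (x i))
    · simpa only [LinearIsometryEquiv.norm_map] using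
        norm_inner_le_norm (𝕜 := ℂ) y (ρ.hom g (x i - y))
  choose y hyf hy using happrox
  choose W hWfd hWi hyW using hyf
  have : ∀ i, CompleteSpace (W i) := fun i => FiniteDimensional.complete ℂ (W i)
  refine ⟨directSum fun i => ρ.restrict (W i) (hWi i), finiteDimensional_directSum hWfd,
    HasNoInvariantVectors.directSum fun i => hρ.restrict (W i) (hWi i),
    ∑ i, fun g => inner ℂ (y i) (ρ.hom g (y i)), ?_, fun g => ?_⟩
  · refine sum_mem_posTypeCone _ fun i _ => posTypeCone_subset_directSum _ i ?_
    exact ⟨1, fun _ g => inner ℂ (y i) (ρ.hom g (y i)), fun _ => ⟨⟨y i, hyW i⟩, rfl⟩, by simp⟩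
  · simp only [Finset.sum_apply, ← Finset.sum_sub_distrib]
    refine (norm_sum_le _ _).trans_lt ?_
    refine (Finset.sum_le_sum fun i _ => (?_ : _ ≤ ε / (n + 1))).trans_lt ?_
    · rw [hx i]
      exact (hy i g).le
    · rw [Finset.sum_const, Finset.card_univ, Fintype.card_fin, nsmul_eq_mul, mul_div_assoc',
        div_lt_iff₀ (by positivity)]
      nlinarith

end UnitaryRep

/-! ### From finite sets to countable compact sets -/

section

variable {G : Type u} [Group G] [TopologicalSpace G]

theorem one_notMem_of_forall_hasNoInvariantVectors {R : Set (UnitaryClass.{u, v} G)}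
    (hR : ∀ ρ : UnitaryRep.{u, v} G, UnitaryClass.mk ρ ∈ R → ρ.HasNoInvariantVectors) :
    UnitaryClass.one G ∉ R :=
  fun h => UnitaryRep.not_hasNoInvariantVectors_trivial (hR _ h)

theorem hasNoInvariantVectors_of_mk_mem_finDimClassesWithoutInvariants {ρ : UnitaryRep.{u, v} G}
    (h : UnitaryClass.mk ρ ∈ finDimClassesWithoutInvariants.{u, v} G) :
    ρ.HasNoInvariantVectors := by
  obtain ⟨σ, hσ, -, hinv⟩ := h
  exact hinv.of_equivalent (UnitaryClass.mk_eq_iff.1 hσ)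

theorem hasNoInvariantVectors_of_mk_mem_discretize_image {ρ : UnitaryRep.{u, v} (Discretization G)}
    (h : UnitaryClass.mk ρ ∈
      UnitaryClass.discretize '' finDimClassesWithoutInvariants.{u, v} G) :
    ρ.HasNoInvariantVectors := by
  obtain ⟨_, ⟨σ, rfl, -, hinv⟩, hσ⟩ := h
  have hd : σ.discretize.HasNoInvariantVectors := hinv
  exact hd.of_equivalent (UnitaryClass.mk_eq_iff.1 hσ)

/-- If finite-dimensional representations without invariant vectors have functions of positive
type close to `1` on all finite sets, they have such functions on countable compact sets. -/
theorem exists_norm_one_sub_lt_of_countable [T2Space G] {C : Set G} (hC : IsCompact C)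
    (hCc : C.Countable)
    (h : ∀ F : Set G, F.Finite → ∀ δ > 0, ∃ σ : UnitaryRep.{u, v} G, FiniteDimensional ℂ σ.V ∧
      σ.HasNoInvariantVectors ∧ ∃ f ∈ σ.posTypeCone, ∀ x ∈ F, ‖1 - f x‖ < δ)
    {ε : ℝ} (hε : 0 < ε) :
    ∃ σ : UnitaryRep.{u, v} G, FiniteDimensional ℂ σ.V ∧
      σ.HasNoInvariantVectors ∧ ∃ f ∈ σ.posTypeCone, ∀ x ∈ C, ‖1 - f x‖ < ε := by
  obtain ⟨e, he⟩ := (hCc.insert 1).exists_eq_range (Set.insert_nonempty _ _)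
  -- The `n`-th function is within `1 / (n + 1)` of `1` on the first `n + 1` points. The identity is
  -- always included, since `‖f n 1‖` bounds `f n` everywhere.
  choose σ hσfd hσ f hf hfe using fun n : ℕ =>
    h (insert 1 (e '' Set.Iic n)) (((Set.finite_Iic n).image e).insert 1) (1 / ((n : ℝ) + 1))
      (by positivity)
  have : CompactSpace C := isCompact_iff_compactSpace.1 hC
  let F : ℕ → C(C, ℂ) := fun n => ⟨fun x => 1 - f n x, continuous_const.sub
    ((UnitaryClass.continuous_of_mem_posTypeCone (c := .mk (σ n)) (hf n)).comp
      continuous_subtype_val)⟩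
  have hbound : ∀ n x, ‖F n x‖ ≤ 3 := by
    intro n x
    have h1 : ‖f n x‖ ≤ ‖f n 1‖ := UnitaryRep.norm_apply_le_of_mem_posTypeCone (hf n) x
    have h2 := hfe n 1 (Set.mem_insert _ _)
    have h3 : 1 / ((n : ℝ) + 1) ≤ 1 := by
      rw [div_le_one (by positivity)]
      linarith [(Nat.cast_nonneg n : (0 : ℝ) ≤ n)]
    have h4 : ‖f n 1‖ ≤ 2 := by
      have := norm_sub_norm_le (f n 1) 1
      rw [norm_sub_rev, norm_one] at this
      linarith
    refine (norm_sub_le (1 : ℂ) (f n x)).trans ?_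
    rw [norm_one]
    linarith
  have hlim : ∀ x, Filter.Tendsto (fun n => F n x) Filter.atTop (𝓝 0) := by
    intro x
    obtain ⟨k, hk⟩ : (x : G) ∈ Set.range e := he ▸ Set.mem_insert_of_mem _ x.2
    refine squeeze_zero_norm' ?_ tendsto_one_div_add_atTop_nhds_zero_nat
    filter_upwards [Filter.eventually_ge_atTop k] with n hn
    exact (hfe n x (Set.mem_insert_of_mem _ ⟨k, hn, hk⟩)).le
  obtain ⟨ι, _, w, n, hw, hw1, hlt⟩ :=
    ContinuousMap.exists_convex_combination_norm_lt hbound hlim hε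
  refine ⟨.directSum fun i => σ (n i), UnitaryRep.finiteDimensional_directSum fun i => hσfd _,
    .directSum fun i => hσ _, ∑ i, fun g => (w i : ℂ) * f (n i) g,
    UnitaryRep.sum_mem_posTypeCone _ fun i _ =>
      UnitaryRep.posTypeCone_subset_directSum (fun i => σ (n i)) i
        (UnitaryRep.smul_mem_posTypeCone (hf (n i)) (hw i)), fun x hx => ?_⟩
  convert hlt ⟨x, hx⟩ using 2
  have hw1' : ∑ i, (w i : ℂ) = 1 := by exact_mod_cast hw1
  simp only [F, ContinuousMap.coe_mk, mul_sub, mul_one, Finset.sum_sub_distrib, hw1',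
    Finset.sum_apply]

end

theorem mainTheorem8 (G : Type u) [Group G] [TopologicalSpace G] [IsTopologicalGroup G]
    (hG : IsPrecompactGroup G) (hcount : ∀ C : Set G, IsCompact C → C.Countable) :
    HasPropertyT.{u, v} G ↔
      HasPropertyTWithRespectTo
        (UnitaryClass.discretize '' finDimClassesWithoutInvariants.{u, v} G) := by
  have hT2 : T2Space G := by
    obtain ⟨K, _, _, _, _, _, φ, hφ⟩ := hG
    exact hφ.t2Space
  rw [hasPropertyTWithRespectTo_iff (one_notMem_of_forall_hasNoInvariantVectors
    fun _ => hasNoInvariantVectors_of_mk_mem_discretize_image)]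
  constructor
  · intro hT
    have hR := hT _ fun _ => hasNoInvariantVectors_of_mk_mem_finDimClassesWithoutInvariants
    rw [hasPropertyTWithRespectTo_iff (one_notMem_of_forall_hasNoInvariantVectors
      fun _ => hasNoInvariantVectors_of_mk_mem_finDimClassesWithoutInvariants)] at hR
    obtain ⟨C, hC, ε, hε, hCε⟩ := hR
    by_contra! hcon
    obtain ⟨σ, hσfd, hσ, f, hf, hlt⟩ :=
      -- Finite sets are compact in `G_d`, so the negated gap condition there supplies the
      -- approximations on finite sets.
      exists_norm_one_sub_lt_of_countable.{u, v} hC (hcount C hC) (fun F hF δ hδ => by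
        obtain ⟨_, ⟨_, ⟨σ, rfl, hσfd, hσ⟩, rfl⟩, f, hf, hlt⟩ :=
          hcon F (Set.Finite.isCompact (X := Discretization G) hF) δ hδ
        exact ⟨σ, hσfd, hσ, f, hf, hlt⟩) hε
    obtain ⟨x, hx, hle⟩ := hCε (.mk σ) ⟨σ, rfl, hσfd, hσ⟩ f hf
    exact absurd (hlt x hx) (not_lt.2 hle)
  · rintro ⟨C, hC, ε, hε, hCε⟩ R hR
    rw [hasPropertyTWithRespectTo_iff (one_notMem_of_forall_hasNoInvariantVectors hR)]
    have hCfin : Set.Finite (α := G) C :=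
      isCompact_iff_finite (X := Discretization G).1 hC
    refine ⟨C, hCfin.isCompact, ε / 2, half_pos hε, fun c hc f hf => ?_⟩
    obtain ⟨ρ, rfl⟩ := c.exists_mk_eq
    -- Half of `ε` pays for replacing `f` by `f'`; the other half remains as the gap for `f`.
    obtain ⟨σ, hσfd, hσ, f', hf', hlt⟩ :=
      UnitaryRep.exists_finiteDimensional_norm_sub_lt hG (hR ρ hc) hf (half_pos hε)
    obtain ⟨x, hx, hle⟩ := hCε _ ⟨_, ⟨σ, rfl, hσfd, hσ⟩, rfl⟩ f' hf'
    refine ⟨x, hx, ?_⟩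
    have h1 : ‖(1 : ℂ) - f' x‖ ≤ ‖1 - f x‖ + ‖f x - f' x‖ := norm_sub_le_norm_sub_add_norm_sub _ _ _
    have h2 : ‖f x - f' x‖ < ε / 2 := hlt x
    have h3 : ε ≤ ‖1 - f' x‖ := hle
    change ε / 2 ≤ ‖1 - f x‖
    linarith
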